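/- For $n \ge 1$ and a $2$-coloring $\gamma : \mathbb{F}_5^n \to \{1,2\}$, call a tuple $(a, a+d, a+2d, a+3d)$ with $a, d \in \mathbb{F}_5^n$ and $d \neq 0$ a $4$-AP, and let $s(\gamma)$ be the number of $4$-APs all of whose entries have the same color under $\gamma$, divided by the number of all $4$-APs in $\mathbb{F}_5^n$. Then the limit $$m_{5,2}(4\text{-AP}) = \lim_{n \to \infty} \, \min_{\gamma : \mathbb{F}_5^n \to \{1,2\}} s(\gamma)$$ exists and satisfies $$\frac{1}{10} < m_{5,2}(4\text{-AP}) \leq \frac{13}{126}.$$ -/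

import Mathlib

open Filter Topology

/-- `solutions A T` is the set of solutions `s = (s_1, …, s_m) ∈ T ^ m` with pairwise distinct
entries of the homogeneous linear system `A · s = 0`, where `A` is an integer matrix with `r` rows
and `m` columns and `T` is a subset of `F ^ n` (in the application, `F` is a finite field). -/
def solutions {F : Type*} [CommRing F] [Fintype F] [DecidableEq F] {r m n : ℕ}
    (A : Matrix (Fin r) (Fin m) ℤ) (T : Finset (Fin n → F)) : Finset (Fin m → (Fin n → F)) :=
  Finset.univ.filter fun s =>
    (∀ j, s j ∈ T) ∧ (∀ i, ∑ j, A i j • s j = 0) ∧ Function.Injective s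

/-- The proportion of all solutions with distinct entries in `F ^ n` that lie in `T`. -/
noncomputable def solutionDensity {F : Type*} [CommRing F] [Fintype F] [DecidableEq F] {r m n : ℕ}
    (A : Matrix (Fin r) (Fin m) ℤ) (T : Finset (Fin n → F)) : ℝ :=
  ((solutions A T).card : ℝ) / ((solutions A (Finset.univ : Finset (Fin n → F))).card : ℝ)

/-- The set of elements of `F ^ n` that receive the color `i`. -/
def colorClass {F : Type*} [Fintype F] {c n : ℕ} (γ : (Fin n → F) → Fin c) (i : Fin c) :
    Finset (Fin n → F) :=
  Finset.univ.filter fun x => γ x = i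

/-- The proportion of monochromatic solutions in the coloring `γ`, as a sum over the colors. -/
noncomputable def monoDensity {F : Type*} [CommRing F] [Fintype F] [DecidableEq F] {r m c n : ℕ}
    (A : Matrix (Fin r) (Fin m) ℤ) (γ : (Fin n → F) → Fin c) : ℝ :=
  ∑ i, solutionDensity A (colorClass γ i)

/-- The minimum proportion of monochromatic solutions over all `c`-colorings of `F ^ n`. -/
noncomputable def minMonoDensity (F : Type*) [CommRing F] [Fintype F] [DecidableEq F]
    (c : ℕ) [NeZero c] {r m : ℕ} (A : Matrix (Fin r) (Fin m) ℤ) (n : ℕ) : ℝ :=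
  (Finset.univ : Finset ((Fin n → F) → Fin c)).inf' Finset.univ_nonempty (monoDensity A)

/-- `μ` is the Rado multiplicity of the system `A` for `c`-colorings over `F`: the limit, as the
dimension `n` tends to infinity, of the minimum proportion of monochromatic solutions. -/
def IsRadoMultiplicity (F : Type*) [CommRing F] [Fintype F] [DecidableEq F]
    (c : ℕ) [NeZero c] {r m : ℕ} (A : Matrix (Fin r) (Fin m) ℤ) (μ : ℝ) : Prop :=
  Tendsto (minMonoDensity F c A) atTop (𝓝 μ)

/-- The system `x₁ - 2 x₂ + x₃ = 0`, `x₂ - 2 x₃ + x₄ = 0` that defines four-term arithmetic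
progressions. -/
def fourAP : Matrix (Fin 2) (Fin 4) ℤ :=
  !![1, -2, 1, 0;
     0, 1, -2, 1]

/-- Over the field with five elements the solutions of `fourAP` with distinct entries are exactly
the progressions `a, a + d, a + 2d, a + 3d` with `d ≠ 0`. -/
theorem mem_solutions_fourAP {n : ℕ} (T : Finset (Fin n → ZMod 5))
    (s : Fin 4 → (Fin n → ZMod 5)) :
    s ∈ solutions fourAP T ↔
      (∀ j, s j ∈ T) ∧ ∃ a d : Fin n → ZMod 5, d ≠ 0 ∧ ∀ j : Fin 4, s j = a + (j : ℕ) • d := by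
  simp only [solutions, Finset.mem_filter, Finset.mem_univ, true_and]
  refine and_congr_right fun _ => ⟨?_, ?_⟩
  · rintro ⟨h, hinj⟩
    have h0 := h 0
    have h1 := h 1
    simp [fourAP, Fin.sum_univ_four] at h0 h1
    refine ⟨s 0, s 1 - s 0, ?_, ?_⟩
    · intro hd
      exact absurd (hinj (sub_eq_zero.mp hd)) (by decide)
    · have e2 : s 2 = s 0 + 2 * (s 1 - s 0) := by linear_combination h0
      have e3 : s 3 = s 0 + 3 * (s 1 - s 0) := by linear_combination h1 + 2 * h0
      intro j
      fin_cases j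
      · simp
      · simp
      · simpa using e2
      · simpa using e3
  · rintro ⟨a, d, hd, hs⟩
    refine ⟨?_, ?_⟩
    · intro i
      fin_cases i <;> simp [fourAP, Fin.sum_univ_four, hs] <;> ring
    · intro i j hij
      rw [hs, hs, add_right_inj] at hij
      obtain ⟨k, hk⟩ := Function.ne_iff.mp hd
      have hk' := congrFun hij k
      simp only [Pi.smul_apply, Pi.zero_apply] at hk hk'
      have key : ∀ (x : ZMod 5) (i j : Fin 4), x ≠ 0 → (i : ℕ) • x = (j : ℕ) • x → i = j := by
        decide
      exact key _ i j hk hk'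

/-! Averaging a coloring of a large space over random affine images of a fixed small space shows
that the minimum in one dimension `m` is at most that in any dimension `n`, up to an error `5⁻ⁿ`
from constant progressions. The minima therefore converge to their supremum.

Lower bound: a 4-AP is a five-point line minus one point. Whether a line splits as 5+0, 4+1 or 3+2
determines both its monochromatic 4-APs and its squared sum of signs (`line_identity`). Averaged
over lines, pair correlations are nonnegative, which gives `1/10` plus a multiple of the density of
monochromatic lines (`card_sq_add_le_monoCount`). Hales–Jewett and the averaging make that density
bounded away from zero.

Upper bound: color the nonzero elements of the field with 125 elements by the quadratic character of
their norm, and color the fiber over zero recursively. The recursion `monoCount_extendColoring_le`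
has limiting density `1612 / (125² - 1) = 13/126`. -/

/-! ### Counting monochromatic progressions -/

section Counting

variable {V : Type*} [AddCommGroup V] [Fintype V] {C : Type*} [DecidableEq C]

/-- Indicator of the event that `a, a + d, …, a + (k - 1) d` have the same color under `γ`. -/
def monoIndicator (k : ℕ) (γ : V → C) (a d : V) : ℕ :=
  if ∀ j : Fin k, γ (a + (j : ℕ) • d) = γ a then 1 else 0

/-- Number of pairs `(a, d)`, with `d = 0` allowed, that give a monochromatic progression. -/
def monoCount (k : ℕ) (γ : V → C) : ℕ := ∑ a, ∑ d, monoIndicator k γ a d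

/-- Number of pairs `(a, d)` with `d ≠ 0` that give a monochromatic progression. -/
def properMonoCount [DecidableEq V] (k : ℕ) (γ : V → C) : ℕ :=
  ∑ a, ∑ d ∈ Finset.univ.erase 0, monoIndicator k γ a d

theorem monoCount_eq_properMonoCount_add [DecidableEq V] (k : ℕ) (γ : V → C) :
    monoCount k γ = properMonoCount k γ + Fintype.card V := by
  have h : ∀ a, ∑ d, monoIndicator k γ a d
      = ∑ d ∈ Finset.univ.erase 0, monoIndicator k γ a d + 1 := by
    intro a
    rw [← Finset.sum_erase_add _ _ (Finset.mem_univ (0 : V))]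
    simp [monoIndicator]
  simp [monoCount, properMonoCount, h, Finset.sum_add_distrib]

end Counting

/-! ### Averaging over affine maps -/

section Averaging

section AffineOf

variable {V : Type*} [AddCommGroup V] [Module (ZMod 5) V] {ι : Type*} [Fintype ι]

/-- The affine map `ι → ZMod 5` to `V` with the given value at `0` and at the unit vectors. -/
def affineOf (v : V) (x : ι → V) (w : ι → ZMod 5) : V := v + ∑ i, w i • x i

theorem affineOf_add_nsmul (v : V) (x : ι → V) (a d : ι → ZMod 5) (j : ℕ) :
    affineOf v x (a + j • d) = affineOf v x a + j • ∑ i, d i • x i := by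
  simp only [affineOf, Pi.add_apply, Pi.smul_apply, add_smul, Finset.sum_add_distrib,
    Finset.smul_sum, smul_assoc, add_assoc]

end AffineOf

variable {V : Type*} [AddCommGroup V] [Module (ZMod 5) V] [Fintype V]
  {ι : Type*} [Fintype ι] [DecidableEq ι]

/-- Since `d ≠ 0`, the base point and the direction of the image are jointly uniform on `V × V`. The
factor `Fintype.card V` on the left avoids the exponent `Fintype.card ι - 1`. -/
theorem sum_affine_pair [Fact (Nat.Prime 5)] (a d : ι → ZMod 5) (hd : d ≠ 0) (F : V → V → ℕ) :
    Fintype.card V * ∑ x : ι → V, ∑ v, F (v + ∑ i, a i • x i) (∑ i, d i • x i)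
      = Fintype.card V ^ Fintype.card ι * ∑ v, ∑ u, F v u := by
  obtain ⟨i₀, hi₀⟩ := Function.ne_iff.mp hd
  have htrans : ∀ x : ι → V, ∑ v, F (v + ∑ i, a i • x i) (∑ i, d i • x i)
      = ∑ v, F v (∑ i, d i • x i) := fun x =>
    Equiv.sum_comp (Equiv.addRight (∑ i, a i • x i)) fun v => F v (∑ i, d i • x i)
  simp only [htrans]
  set G : V → ℕ := fun u => ∑ v, F v u with hG
  -- Translating the single coordinate `x i₀` by `(d i₀)⁻¹ • u` moves the direction by `u`.
  have hshift : ∀ u : V, ∑ x : ι → V, G (∑ i, d i • x i) = ∑ x : ι → V, G (∑ i, d i • x i + u) := by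
    intro u
    rw [← Equiv.sum_comp (Equiv.addRight (Pi.single i₀ ((d i₀)⁻¹ • u) : ι → V))]
    refine Finset.sum_congr rfl fun x _ => ?_
    congr 1
    simp only [Equiv.coe_addRight, Pi.add_apply, smul_add, Finset.sum_add_distrib]
    congr 1
    rw [Finset.sum_eq_single i₀]
    · rw [Pi.single_eq_same, smul_smul, mul_inv_cancel₀ hi₀, one_smul]
    · intro j _ hj
      rw [Pi.single_eq_of_ne hj, smul_zero]
    · simp
  calc Fintype.card V * ∑ x : ι → V, G (∑ i, d i • x i)
      = ∑ u : V, ∑ x : ι → V, G (∑ i, d i • x i) := by simp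
    _ = ∑ u : V, ∑ x : ι → V, G (∑ i, d i • x i + u) := Finset.sum_congr rfl fun u _ => hshift u
    _ = ∑ x : ι → V, ∑ u : V, G (∑ i, d i • x i + u) := Finset.sum_comm
    _ = ∑ x : ι → V, ∑ u : V, G u := Finset.sum_congr rfl fun x _ =>
        Equiv.sum_comp (Equiv.addLeft (∑ i, d i • x i)) G
    _ = Fintype.card V ^ Fintype.card ι * ∑ v, ∑ u, F v u := by
        rw [Finset.sum_comm (f := F)]
        simp [hG]

variable {C : Type*} [DecidableEq C]

/-- The maps need not be injective, so a nonzero direction may be sent to zero; hence `monoCount`,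
not `properMonoCount`, on the right. -/
theorem sum_properMonoCount_affine (k : ℕ) (γ : V → C) :
    Fintype.card V * ∑ x : ι → V, ∑ v, properMonoCount k (γ ∘ affineOf v x)
      = 5 ^ Fintype.card ι * (5 ^ Fintype.card ι - 1)
        * (Fintype.card V ^ Fintype.card ι * monoCount k γ) := by
  have : Fact (Nat.Prime 5) := ⟨by norm_num⟩
  have hind : ∀ (x : ι → V) (v : V) (a d : ι → ZMod 5),
      monoIndicator k (γ ∘ affineOf v x) a d
        = monoIndicator k γ (v + ∑ i, a i • x i) (∑ i, d i • x i) := by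
    intro x v a d
    simp only [monoIndicator, Function.comp_apply, affineOf_add_nsmul]
    rfl
  have hswap : ∑ x : ι → V, ∑ v, properMonoCount k (γ ∘ affineOf v x)
      = ∑ a : ι → ZMod 5, ∑ d ∈ Finset.univ.erase (0 : ι → ZMod 5), ∑ x : ι → V, ∑ v,
        monoIndicator k γ (v + ∑ i, a i • x i) (∑ i, d i • x i) := by
    simp only [properMonoCount, hind]
    calc _ = ∑ x : ι → V, ∑ a : ι → ZMod 5, ∑ v : V, ∑ d ∈ Finset.univ.erase (0 : ι → ZMod 5),
          monoIndicator k γ (v + ∑ i, a i • x i) (∑ i, d i • x i) :=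
          Finset.sum_congr rfl fun x _ => Finset.sum_comm
      _ = ∑ a : ι → ZMod 5, ∑ x : ι → V, ∑ v : V, ∑ d ∈ Finset.univ.erase (0 : ι → ZMod 5),
          monoIndicator k γ (v + ∑ i, a i • x i) (∑ i, d i • x i) := Finset.sum_comm
      _ = ∑ a : ι → ZMod 5, ∑ x : ι → V, ∑ d ∈ Finset.univ.erase (0 : ι → ZMod 5), ∑ v : V,
          monoIndicator k γ (v + ∑ i, a i • x i) (∑ i, d i • x i) :=
          Finset.sum_congr rfl fun a _ => Finset.sum_congr rfl fun x _ => Finset.sum_comm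
      _ = _ := Finset.sum_congr rfl fun a _ => Finset.sum_comm
  rw [hswap, Finset.mul_sum]
  simp only [Finset.mul_sum (Finset.univ.erase (0 : ι → ZMod 5))]
  rw [Finset.sum_congr rfl fun a _ => Finset.sum_congr rfl fun d hd =>
    sum_affine_pair a d (Finset.ne_of_mem_erase hd) (monoIndicator k γ)]
  simp only [Finset.sum_const, smul_eq_mul, Finset.card_univ,
    Finset.card_erase_of_mem (Finset.mem_univ _), Fintype.card_fun, ZMod.card, monoCount]
  ring

/-- A lower bound for the number of monochromatic progressions in all colorings of `ι → ZMod 5`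
passes to all colorings of `ZMod 5`-modules. -/
theorem mul_card_sq_le_monoCount (k : ℕ) (γ : V → C) (c : ℝ)
    (hc : ∀ δ : (ι → ZMod 5) → C, c ≤ properMonoCount k δ) :
    c * (Fintype.card V : ℝ) ^ 2
      ≤ (5 : ℝ) ^ Fintype.card ι * ((5 : ℝ) ^ Fintype.card ι - 1) * monoCount k γ := by
  have hV : (0 : ℝ) < Fintype.card V := by exact_mod_cast Fintype.card_pos
  have key := congrArg (Nat.cast : ℕ → ℝ) (sum_properMonoCount_affine (ι := ι) k γ)
  push_cast [Nat.cast_sub (Nat.one_le_pow (Fintype.card ι) 5 (by norm_num))] at key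
  have hsum : (Fintype.card V : ℝ) ^ Fintype.card ι * (Fintype.card V * c)
      ≤ ∑ x : ι → V, ∑ v, (properMonoCount k (γ ∘ affineOf v x) : ℝ) := by
    calc _ = ∑ x : ι → V, ∑ v : V, c := by simp
      _ ≤ _ := Finset.sum_le_sum fun x _ => Finset.sum_le_sum fun v _ => hc _
  have hle := mul_le_mul_of_nonneg_left hsum hV.le
  rw [key] at hle
  have hpow : (0 : ℝ) < (Fintype.card V : ℝ) ^ Fintype.card ι := by positivity
  refine le_of_mul_le_mul_left ?_ hpow
  linarith

end Averaging

/-! ### Lower bound -/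

section LowerBound

/-- Every coloring of a high-dimensional space over `ZMod 5` has a monochromatic line. -/
theorem exists_dim_one_le_properMonoCount (C : Type*) [Finite C] [Nonempty C]
    [DecidableEq C] :
    ∃ (ι : Type) (_ : Fintype ι) (_ : DecidableEq ι), 0 < Fintype.card ι ∧
      ∀ δ : (ι → ZMod 5) → C, 1 ≤ properMonoCount 5 δ := by
  classical
  obtain ⟨ι, hι, h⟩ := Combinatorics.Line.exists_mono_in_high_dimension (ZMod 5) C
  refine ⟨ι, hι, inferInstance, ?_, fun δ => ?_⟩
  · obtain ⟨l, _⟩ := h fun _ => Classical.arbitrary C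
    exact Fintype.card_pos_iff.mpr ⟨l.proper.choose⟩
  obtain ⟨l, c, hl⟩ := h δ
  obtain ⟨i₀, hi₀⟩ := l.proper
  -- The indicator of the active coordinates is the direction of the combinatorial line.
  set d : ι → ZMod 5 := fun i => if l.idxFun i = none then 1 else 0 with hd
  have hd0 : d ≠ 0 := fun h0 => by
    have := congrFun h0 i₀
    simp only [hd, hi₀, if_true, Pi.zero_apply] at this
    exact absurd this (by decide)
  have hline : ∀ j : ℕ, l 0 + j • d = l (j : ZMod 5) := by
    intro j
    ext i
    cases hi : l.idxFun i <;> simp [hd, hi, Combinatorics.Line.apply_def]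
  have hone : monoIndicator 5 δ (l 0) d = 1 := by
    rw [monoIndicator, if_pos]
    intro j
    rw [hline, hl, hl]
  rw [← hone]
  refine le_trans ?_ (Finset.single_le_sum (f := fun a => ∑ d ∈ Finset.univ.erase 0,
    monoIndicator 5 δ a d) (fun _ _ => Nat.zero_le _) (Finset.mem_univ (l 0)))
  exact Finset.single_le_sum (f := fun d => monoIndicator 5 δ (l 0) d)
    (fun _ _ => Nat.zero_le _) (Finset.mem_erase.mpr ⟨hd0, Finset.mem_univ d⟩)

/-- The sign `±1` attached to a color. -/
def colorSign (c : Fin 2) : ℤ := if c = 0 then 1 else -1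

theorem colorSign_sq (c : Fin 2) : colorSign c * colorSign c = 1 := by
  revert c; decide

/-- For splits 5+0, 4+1, 3+2 the first sum is 5, 1, 0 and the squared sign sum is 25, 9, 1. -/
theorem line_identity (c : ZMod 5 → Fin 2) :
    8 * (∑ i : ZMod 5, if ∀ j : Fin 4, c (i + ((j : ℕ) : ZMod 5)) = c i then (1 : ℤ) else 0) + 1
      = (∑ i, colorSign (c i)) ^ 2
        + 16 * (if ∀ j : Fin 5, c (((j : ℕ) : ZMod 5)) = c 0 then 1 else 0) := by
  revert c; decide +kernel

variable {V : Type*} [AddCommGroup V] [Module (ZMod 5) V]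

theorem line_identity_monoIndicator (γ : V → Fin 2) (a d : V) :
    8 * (∑ i : ZMod 5, (monoIndicator 4 γ (a + i • d) d : ℤ)) + 1
      = (∑ i : ZMod 5, colorSign (γ (a + i • d))) ^ 2 + 16 * (monoIndicator 5 γ a d : ℤ) := by
  have h := line_identity fun i => γ (a + i • d)
  simpa [monoIndicator, add_smul, Nat.cast_smul_eq_nsmul, add_assoc] using h

variable [Fintype V]

/-- As `j - i` is invertible, the two points range independently over `V`, and the sum is the square
of the total sign. -/
theorem sum_colorSign_mul_nonneg [Fact (Nat.Prime 5)] (γ : V → Fin 2) {i j : ZMod 5}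
    (hij : i ≠ j) :
    0 ≤ ∑ a : V, ∑ d : V, colorSign (γ (a + i • d)) * colorSign (γ (a + j • d)) := by
  have hu : IsUnit (j - i) := (sub_ne_zero.mpr hij.symm).isUnit
  have h1 : ∑ a : V, ∑ d : V, colorSign (γ (a + i • d)) * colorSign (γ (a + j • d))
      = ∑ d : V, ∑ a : V, colorSign (γ a) * colorSign (γ (a + (j - i) • d)) := by
    rw [Finset.sum_comm]
    refine Finset.sum_congr rfl fun d _ => ?_
    rw [← Equiv.sum_comp (Equiv.addRight (i • d)) fun a =>
      colorSign (γ a) * colorSign (γ (a + (j - i) • d))]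
    refine Finset.sum_congr rfl fun a _ => ?_
    simp only [Equiv.coe_addRight, add_assoc, ← add_smul, add_sub_cancel]
  have h2 : ∀ a : V, ∑ d : V, colorSign (γ (a + (j - i) • d)) = ∑ b : V, colorSign (γ b) := by
    intro a
    have e := Equiv.sum_comp ((MulAction.toPerm hu.unit : Equiv.Perm V).trans (Equiv.addLeft a))
      fun b => colorSign (γ b)
    rw [← e]
    rfl
  rw [h1, Finset.sum_comm]
  simp only [← Finset.mul_sum, h2, ← Finset.sum_mul]
  exact mul_self_nonneg _

/-- On lines of five points the pair correlations and the monochromatic lines control the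
monochromatic four-term progressions. -/
theorem card_sq_add_le_monoCount (γ : V → Fin 2) :
    Fintype.card V ^ 2 + 4 * monoCount 5 γ ≤ 10 * monoCount 4 γ := by
  have : Fact (Nat.Prime 5) := ⟨by norm_num⟩
  have hshift : ∀ i : ZMod 5, ∑ a : V, ∑ d : V, (monoIndicator 4 γ (a + i • d) d : ℤ)
      = monoCount 4 γ := by
    intro i
    rw [monoCount, Finset.sum_comm, Finset.sum_comm (f := monoIndicator 4 γ)]
    push_cast
    exact Finset.sum_congr rfl fun d _ =>
      Equiv.sum_comp (Equiv.addRight (i • d)) fun a => (monoIndicator 4 γ a d : ℤ)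
  have hsq : 5 * (Fintype.card V : ℤ) ^ 2
      ≤ ∑ a : V, ∑ d : V, (∑ i : ZMod 5, colorSign (γ (a + i • d))) ^ 2 := by
    have hexp : ∑ a : V, ∑ d : V, (∑ i : ZMod 5, colorSign (γ (a + i • d))) ^ 2
        = ∑ i : ZMod 5, ∑ j : ZMod 5, ∑ a : V, ∑ d : V,
          colorSign (γ (a + i • d)) * colorSign (γ (a + j • d)) := by
      simp only [sq, Finset.sum_mul_sum]
      simp only [Finset.sum_comm (s := (Finset.univ : Finset V)) (t := (Finset.univ : Finset (ZMod 5)))]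
    rw [hexp]
    have hle : ∀ i j : ZMod 5, (if i = j then (Fintype.card V : ℤ) ^ 2 else 0)
        ≤ ∑ a : V, ∑ d : V, colorSign (γ (a + i • d)) * colorSign (γ (a + j • d)) := by
      intro i j
      split_ifs with hij
      · subst hij
        simp [colorSign_sq, sq]
      · exact sum_colorSign_mul_nonneg γ hij
    calc 5 * (Fintype.card V : ℤ) ^ 2
        = ∑ i : ZMod 5, ∑ j : ZMod 5, (if i = j then (Fintype.card V : ℤ) ^ 2 else 0) := by
          simp [ZMod.card]
      _ ≤ _ := Finset.sum_le_sum fun i _ => Finset.sum_le_sum fun j _ => hle i j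
  have hsum : 8 * (5 * (monoCount 4 γ : ℤ)) + (Fintype.card V : ℤ) ^ 2
      = ∑ a : V, ∑ d : V, (∑ i : ZMod 5, colorSign (γ (a + i • d))) ^ 2
        + 16 * (monoCount 5 γ : ℤ) := by
    have h := Finset.sum_congr (rfl : (Finset.univ : Finset V) = Finset.univ) fun a _ =>
      Finset.sum_congr (rfl : (Finset.univ : Finset V) = Finset.univ) fun d _ =>
        line_identity_monoIndicator γ a d
    simp only [Finset.sum_add_distrib, ← Finset.mul_sum] at h
    have h5 : ∑ a : V, ∑ d : V, ∑ i : ZMod 5, (monoIndicator 4 γ (a + i • d) d : ℤ)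
        = 5 * (monoCount 4 γ : ℤ) := by
      calc _ = ∑ i : ZMod 5, ∑ a : V, ∑ d : V, (monoIndicator 4 γ (a + i • d) d : ℤ) := by
            simp only [Finset.sum_comm (s := (Finset.univ : Finset V))
              (t := (Finset.univ : Finset (ZMod 5)))]
        _ = _ := by simp [hshift, ZMod.card]
    rw [h5] at h
    simpa [monoCount, sq] using h
  zify
  linarith

end LowerBound

/-! ### Upper bound -/

section UpperBound

/-- The norm form of the cubic extension of `ZMod 5` generated by a root of `t ^ 3 + t + 1`, in the
basis `1, t, t ^ 2`. -/
def normForm (x : ZMod 5 × ZMod 5 × ZMod 5) : ZMod 5 :=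
  x.1 ^ 3 - x.2.1 ^ 3 + x.2.2 ^ 3 - 2 * x.1 ^ 2 * x.2.2 + x.1 * x.2.1 ^ 2 + x.1 * x.2.2 ^ 2
    + 3 * x.1 * x.2.1 * x.2.2 - x.2.1 * x.2.2 ^ 2

/-- Multiplication of the cubic extension with norm form `normForm`. -/
def cubicMul (x y : ZMod 5 × ZMod 5 × ZMod 5) : ZMod 5 × ZMod 5 × ZMod 5 :=
  (x.1 * y.1 - (x.2.1 * y.2.2 + x.2.2 * y.2.1),
   x.1 * y.2.1 + x.2.1 * y.1 - (x.2.1 * y.2.2 + x.2.2 * y.2.1) - x.2.2 * y.2.2,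
   x.1 * y.2.2 + x.2.1 * y.2.1 + x.2.2 * y.1 - x.2.2 * y.2.2)

theorem normForm_cubicMul (x y : ZMod 5 × ZMod 5 × ZMod 5) :
    normForm (cubicMul x y) = normForm x * normForm y := by
  simp only [normForm, cubicMul]
  ring

theorem cubicMul_comm (x y : ZMod 5 × ZMod 5 × ZMod 5) : cubicMul x y = cubicMul y x := by
  ext <;> simp only [cubicMul] <;> ring

theorem cubicMul_assoc (x y z : ZMod 5 × ZMod 5 × ZMod 5) :
    cubicMul (cubicMul x y) z = cubicMul x (cubicMul y z) := by
  ext <;> simp only [cubicMul] <;> ring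

theorem one_cubicMul (x : ZMod 5 × ZMod 5 × ZMod 5) : cubicMul (1, 0, 0) x = x := by
  ext <;> simp [cubicMul]

theorem cubicMul_zero (x : ZMod 5 × ZMod 5 × ZMod 5) : cubicMul x 0 = 0 := by
  ext <;> simp [cubicMul]

theorem cubicMul_add_nsmul (x a d : ZMod 5 × ZMod 5 × ZMod 5) (j : ℕ) :
    cubicMul x (a + j • d) = cubicMul x a + j • cubicMul x d := by
  ext <;> simp [cubicMul] <;> ring

theorem normForm_ne_zero : ∀ x : ZMod 5 × ZMod 5 × ZMod 5, x ≠ 0 → normForm x ≠ 0 := by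
  decide +kernel

theorem exists_cubicMul_eq_one (x : ZMod 5 × ZMod 5 × ZMod 5) (hx : x ≠ 0) :
    ∃ y, cubicMul y x = (1, 0, 0) := by
  have : Fact (Nat.Prime 5) := ⟨by norm_num⟩
  have hN := normForm_ne_zero x hx
  -- The inverse is the product of the other two conjugates divided by the norm.
  refine ⟨((normForm x)⁻¹ * ((x.1 - x.2.2) ^ 2 + x.2.1 * (x.2.1 + x.2.2)),
    (normForm x)⁻¹ * (-(x.1 * x.2.1) - x.2.2 ^ 2),
    (normForm x)⁻¹ * (x.2.1 ^ 2 - x.2.2 * (x.1 - x.2.2))), ?_⟩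
  ext
  · simp only [cubicMul]
    field_simp
    simp only [normForm]
    ring
  · simp only [cubicMul]
    field_simp
    ring
  · simp only [cubicMul]
    field_simp
    ring

/-- The nonzero members of `a, a + d, a + 2d, a + 3d` have norms with the same square. -/
def NormConstant (a d : ZMod 5 × ZMod 5 × ZMod 5) : Prop :=
  ∀ i j : Fin 4, a + (i : ℕ) • d ≠ 0 → a + (j : ℕ) • d ≠ 0 →
    normForm (a + (i : ℕ) • d) ^ 2 = normForm (a + (j : ℕ) • d) ^ 2

instance (a d : ZMod 5 × ZMod 5 × ZMod 5) : Decidable (NormConstant a d) := by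
  unfold NormConstant; infer_instance

theorem card_normConstant_one :
    (Finset.univ.filter fun a => NormConstant a (1, 0, 0)).card = 12 := by
  decide +kernel

theorem NormConstant.cubicMul_left {a d : ZMod 5 × ZMod 5 × ZMod 5} (h : NormConstant a d)
    (x : ZMod 5 × ZMod 5 × ZMod 5) : NormConstant (cubicMul x a) (cubicMul x d) := by
  intro i j hi hj
  simp only [← cubicMul_add_nsmul] at hi hj ⊢
  rw [normForm_cubicMul, normForm_cubicMul, mul_pow, mul_pow, h i j]
  · exact fun h0 => hi (by rw [h0, cubicMul_zero])
  · exact fun h0 => hj (by rw [h0, cubicMul_zero])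

/-- The norm is multiplicative, so multiplication by the inverse of `d` reduces to direction 1, a
finite check. -/
theorem card_normConstant_le (d : ZMod 5 × ZMod 5 × ZMod 5) (hd : d ≠ 0) :
    (Finset.univ.filter fun a => NormConstant a d).card ≤ 12 := by
  obtain ⟨y, hy⟩ := exists_cubicMul_eq_one d hd
  rw [← card_normConstant_one]
  refine Finset.card_le_card_of_injOn (cubicMul y) ?_ ?_
  · intro a ha
    simp only [Finset.coe_filter, Finset.mem_univ, true_and, Set.mem_ofPred_eq] at ha ⊢
    rw [← hy]
    exact ha.cubicMul_left y
  · intro a _ b _ hab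
    have h := congrArg (cubicMul d) hab
    simpa only [← cubicMul_assoc, cubicMul_comm d y, hy, one_cubicMul] using h

/-- Colors `(x, v)` by the norm of `x` if `x ≠ 0`, and by `γ v` otherwise. -/
def extendColoring {V : Type*} (γ : V → Fin 2) (p : (ZMod 5 × ZMod 5 × ZMod 5) × V) : Fin 2 :=
  if p.1 = 0 then γ p.2 else if normForm p.1 ^ 2 = 1 then 1 else 0

theorem normForm_sq_eq_of_extendColoring_eq {V : Type*} (γ : V → Fin 2)
    {p q : (ZMod 5 × ZMod 5 × ZMod 5) × V} (hp : p.1 ≠ 0) (hq : q.1 ≠ 0)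
    (h : extendColoring γ p = extendColoring γ q) : normForm p.1 ^ 2 = normForm q.1 ^ 2 := by
  have key : ∀ u v : ZMod 5, u ≠ 0 → v ≠ 0 →
      ((if u ^ 2 = 1 then 1 else 0 : Fin 2) = if v ^ 2 = 1 then 1 else 0) → u ^ 2 = v ^ 2 := by
    decide
  refine key _ _ (normForm_ne_zero _ hp) (normForm_ne_zero _ hq) ?_
  simpa only [extendColoring, if_neg hp, if_neg hq] using h

variable {V : Type*} [AddCommGroup V]

theorem normConstant_of_monoIndicator_ne_zero (γ : V → Fin 2)
    (p q : (ZMod 5 × ZMod 5 × ZMod 5) × V)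
    (h : monoIndicator 4 (extendColoring γ) p q ≠ 0) : NormConstant p.1 q.1 := by
  have hm : ∀ j : Fin 4, extendColoring γ (p + (j : ℕ) • q) = extendColoring γ p := by
    by_contra hn
    exact h (if_neg hn)
  intro i j hi hj
  exact normForm_sq_eq_of_extendColoring_eq γ (p := p + (i : ℕ) • q) (q := p + (j : ℕ) • q)
    hi hj ((hm i).trans (hm j).symm)

variable [Fintype V]

theorem sum_monoIndicator_extendColoring_zero (γ : V → Fin 2) :
    ∑ v, ∑ w, monoIndicator 4 (extendColoring γ) (0, v) (0, w) = monoCount 4 γ := by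
  simp [monoIndicator, monoCount, extendColoring]

/-- Here `1612 = 124 * 12 + 124`: at most 12 base points for each nonzero `d`, and the 124 nonzero
base points for `d = 0`. The pair `(0, 0)` reproduces `γ`. -/
theorem monoCount_extendColoring_le (γ : V → Fin 2) :
    monoCount 4 (extendColoring γ) ≤ 1612 * Fintype.card V ^ 2 + monoCount 4 γ := by
  set N := Fintype.card V with hN
  set S : (ZMod 5 × ZMod 5 × ZMod 5) → (ZMod 5 × ZMod 5 × ZMod 5) → ℕ := fun a d =>
    ∑ v, ∑ w, monoIndicator 4 (extendColoring γ) (a, v) (d, w) with hS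
  have hcount : monoCount 4 (extendColoring γ) = ∑ d, ∑ a, S a d := by
    rw [monoCount, Fintype.sum_prod_type, Finset.sum_comm (f := fun d a => S a d)]
    refine Finset.sum_congr rfl fun a _ => ?_
    rw [Fintype.sum_congr _ _ fun v => Fintype.sum_prod_type
      (monoIndicator 4 (extendColoring γ) (a, v)), Finset.sum_comm]
  have hbound : ∀ a d, S a d ≤ N ^ 2 := by
    intro a d
    calc S a d ≤ ∑ v : V, ∑ w : V, 1 := by
          refine Finset.sum_le_sum fun v _ => Finset.sum_le_sum fun w _ => ?_
          unfold monoIndicator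
          split_ifs <;> simp
      _ = N ^ 2 := by simp [sq, hN]
  have hzero : ∀ a d, ¬ NormConstant a d → S a d = 0 := by
    intro a d h
    refine Finset.sum_eq_zero fun v _ => Finset.sum_eq_zero fun w _ => ?_
    by_contra hne
    exact h (normConstant_of_monoIndicator_ne_zero γ (a, v) (d, w) hne)
  have hd : ∀ d, d ≠ 0 → ∑ a, S a d ≤ 12 * N ^ 2 := by
    intro d hd
    calc ∑ a, S a d ≤ ∑ a, if NormConstant a d then N ^ 2 else 0 := by
          refine Finset.sum_le_sum fun a _ => ?_
          split_ifs with h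
          · exact hbound a d
          · exact (hzero a d h).le
      _ = (Finset.univ.filter fun a => NormConstant a d).card * N ^ 2 := by
          rw [← Finset.sum_filter, Finset.sum_const, smul_eq_mul]
      _ ≤ 12 * N ^ 2 := Nat.mul_le_mul_right _ (card_normConstant_le d hd)
  have h0 : ∑ a, S a 0 ≤ 124 * N ^ 2 + monoCount 4 γ := by
    rw [← Finset.sum_erase_add _ _ (Finset.mem_univ (0 : ZMod 5 × ZMod 5 × ZMod 5))]
    refine add_le_add ?_ (sum_monoIndicator_extendColoring_zero γ).le
    refine (Finset.sum_le_card_nsmul _ _ _ fun a _ => hbound a 0).trans (le_of_eq ?_)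
    simp [Finset.card_erase_of_mem, ZMod.card]
  rw [hcount, ← Finset.sum_erase_add _ _ (Finset.mem_univ (0 : ZMod 5 × ZMod 5 × ZMod 5))]
  have h1 := Finset.sum_le_card_nsmul (Finset.univ.erase (0 : ZMod 5 × ZMod 5 × ZMod 5))
    (fun d => ∑ a, S a d) (12 * N ^ 2) fun d hd' => hd d (Finset.ne_of_mem_erase hd')
  have hcard : (Finset.univ.erase (0 : ZMod 5 × ZMod 5 × ZMod 5)).card = 124 := by
    simp [Finset.card_erase_of_mem, ZMod.card]
  rw [hcard, smul_eq_mul] at h1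
  linarith

/-- The bound is exactly preserved by the recursion, as `126 * 1612 + 13 = 13 * 125 ^ 2`; `113 = 126
- 13` fits the one-point space. -/
theorem exists_coloring_monoCount_le (k : ℕ) :
    ∃ (V : Type) (_ : AddCommGroup V) (_ : Module (ZMod 5) V) (_ : Fintype V) (γ : V → Fin 2),
      Fintype.card V = 125 ^ k ∧ 126 * monoCount 4 γ ≤ 13 * Fintype.card V ^ 2 + 113 := by
  induction k with
  | zero =>
    refine ⟨Fin 0 → ZMod 5, inferInstance, inferInstance, inferInstance, fun _ => 0, by simp, ?_⟩
    simp [monoCount, monoIndicator]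
  | succ k ih =>
    obtain ⟨V, _, _, _, γ, hcard, hγ⟩ := ih
    have hc : Fintype.card ((ZMod 5 × ZMod 5 × ZMod 5) × V) = 125 * Fintype.card V := by
      simp [Fintype.card_prod, ZMod.card]
    refine ⟨(ZMod 5 × ZMod 5 × ZMod 5) × V, inferInstance, inferInstance, inferInstance,
      extendColoring γ, by rw [hc, hcard, pow_succ, mul_comm], ?_⟩
    have h := monoCount_extendColoring_le γ
    rw [hc]
    nlinarith

end UpperBound

/-! ### Densities and the limit -/

section Limit

theorem card_solutions_fourAP {n : ℕ} (T : Finset (Fin n → ZMod 5)) :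
    (solutions fourAP T).card
      = ∑ a : Fin n → ZMod 5, ∑ d ∈ Finset.univ.erase (0 : Fin n → ZMod 5),
        if ∀ j : Fin 4, a + (j : ℕ) • d ∈ T then 1 else 0 := by
  rw [← Finset.sum_product', ← Finset.sum_filter, ← Finset.card_eq_sum_ones]
  symm
  refine Finset.card_bij (fun p _ (j : Fin 4) => p.1 + (j : ℕ) • p.2) ?_ ?_ ?_
  · intro p hp
    simp only [Finset.mem_filter, Finset.mem_product, Finset.mem_erase] at hp
    exact (mem_solutions_fourAP T _).mpr ⟨hp.2, p.1, p.2, hp.1.2.1, fun _ => rfl⟩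
  · intro p _ q _ h
    have h0 := congrFun h 0
    have h1 := congrFun h 1
    simp only [Fin.val_zero, zero_smul, add_zero, Fin.val_one, one_smul] at h0 h1
    exact Prod.ext h0 (by rw [h0] at h1; exact add_left_cancel h1)
  · intro s hs
    obtain ⟨hT, a, d, hd, h⟩ := (mem_solutions_fourAP T s).mp hs
    refine ⟨(a, d), ?_, (funext h).symm⟩
    simp only [Finset.mem_filter, Finset.mem_product, Finset.mem_erase, Finset.mem_univ, true_and,
      and_true]
    exact ⟨hd, fun j => h j ▸ hT j⟩

theorem monoDensity_fourAP {n : ℕ} (γ : (Fin n → ZMod 5) → Fin 2) :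
    monoDensity fourAP γ = (properMonoCount 4 γ : ℝ) / ((5 : ℝ) ^ n * ((5 : ℝ) ^ n - 1)) := by
  have huniv : ((solutions fourAP (Finset.univ : Finset (Fin n → ZMod 5))).card : ℝ)
      = (5 : ℝ) ^ n * ((5 : ℝ) ^ n - 1) := by
    rw [card_solutions_fourAP]
    simp [Finset.card_erase_of_mem, ZMod.card]
  have hcolor : ∑ i, (solutions fourAP (colorClass γ i)).card = properMonoCount 4 γ := by
    simp only [card_solutions_fourAP, properMonoCount]
    rw [Finset.sum_comm]
    refine Finset.sum_congr rfl fun a _ => ?_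
    rw [Finset.sum_comm]
    refine Finset.sum_congr rfl fun d _ => ?_
    rw [Finset.sum_eq_single (γ a)]
    · simp [monoIndicator, colorClass]
    · intro i _ hi
      refine if_neg fun h => hi (Eq.symm ?_)
      simpa [colorClass] using h 0
    · simp
  simp only [monoDensity, solutionDensity, huniv, ← Finset.sum_div]
  rw [← hcolor]
  push_cast
  rfl

theorem five_pow_sub_one_pos {n : ℕ} (hn : 1 ≤ n) : (0 : ℝ) < (5 : ℝ) ^ n - 1 := by
  have := one_lt_pow₀ (by norm_num : (1 : ℝ) < 5) (Nat.one_le_iff_ne_zero.mp hn)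
  linarith

/-- The minimum density for one space bounds from below the density of monochromatic
progressions, constant ones included, in every `ZMod 5`-module. -/
theorem minMonoDensity_mul_card_sq_le {m : ℕ} (hm : 1 ≤ m) {V : Type*} [AddCommGroup V]
    [Module (ZMod 5) V] [Fintype V] (γ : V → Fin 2) :
    minMonoDensity (ZMod 5) 2 fourAP m * (Fintype.card V : ℝ) ^ 2 ≤ monoCount 4 γ := by
  have hpos : (0 : ℝ) < (5 : ℝ) ^ m * ((5 : ℝ) ^ m - 1) :=
    mul_pos (by positivity) (five_pow_sub_one_pos hm)
  have h := mul_card_sq_le_monoCount (ι := Fin m) 4 γ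
    (minMonoDensity (ZMod 5) 2 fourAP m * ((5 : ℝ) ^ m * ((5 : ℝ) ^ m - 1))) fun δ => by
      rw [← le_div_iff₀ hpos, ← monoDensity_fourAP]
      exact Finset.inf'_le _ (Finset.mem_univ δ)
  rw [Fintype.card_fin] at h
  refine le_of_mul_le_mul_left ?_ hpos
  linarith

theorem monoCount_div_le_monoDensity {n : ℕ} (hn : 1 ≤ n) (γ : (Fin n → ZMod 5) → Fin 2) :
    (monoCount 4 γ : ℝ) / ((5 : ℝ) ^ n) ^ 2 ≤ monoDensity fourAP γ + ((5 : ℝ) ^ n)⁻¹ := by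
  have hN : (0 : ℝ) < (5 : ℝ) ^ n := by positivity
  have hN1 := five_pow_sub_one_pos hn
  have hc : (monoCount 4 γ : ℝ) = properMonoCount 4 γ + (5 : ℝ) ^ n := by
    rw [monoCount_eq_properMonoCount_add]
    simp [ZMod.card]
  rw [monoDensity_fourAP, hc, add_div]
  refine add_le_add ?_ (le_of_eq (by field_simp))
  refine div_le_div_of_nonneg_left (Nat.cast_nonneg _) (mul_pos hN hN1) ?_
  rw [sq]
  exact mul_le_mul_of_nonneg_left (by linarith) hN.le

theorem le_minMonoDensity_add {n : ℕ} (hn : 1 ≤ n) (c : ℝ)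
    (hc : ∀ γ : (Fin n → ZMod 5) → Fin 2, c * ((5 : ℝ) ^ n) ^ 2 ≤ monoCount 4 γ) :
    c ≤ minMonoDensity (ZMod 5) 2 fourAP n + ((5 : ℝ) ^ n)⁻¹ := by
  rw [← sub_le_iff_le_add]
  refine Finset.le_inf' _ _ fun γ _ => ?_
  rw [sub_le_iff_le_add]
  refine le_trans ?_ (monoCount_div_le_monoDensity hn γ)
  rw [le_div_iff₀ (by positivity)]
  exact hc γ

theorem minMonoDensity_le_add {m n : ℕ} (hm : 1 ≤ m) (hn : 1 ≤ n) :
    minMonoDensity (ZMod 5) 2 fourAP m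
      ≤ minMonoDensity (ZMod 5) 2 fourAP n + ((5 : ℝ) ^ n)⁻¹ := by
  refine le_minMonoDensity_add hn _ fun γ => ?_
  simpa [ZMod.card] using minMonoDensity_mul_card_sq_le hm γ

theorem minMonoDensity_le {m : ℕ} (hm : 1 ≤ m) :
    minMonoDensity (ZMod 5) 2 fourAP m ≤ 13 / 126 := by
  -- With `m` fixed, the test space grows with `k` and the additive error vanishes.
  have hk : ∀ k : ℕ, minMonoDensity (ZMod 5) 2 fourAP m
      ≤ 13 / 126 + 113 / 126 * ((1 / 125 : ℝ) ^ 2) ^ k := by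
    intro k
    obtain ⟨V, _, _, _, γ, hcard, hγ⟩ := exists_coloring_monoCount_le k
    have h := minMonoDensity_mul_card_sq_le hm γ
    have hγ' : (126 : ℝ) * monoCount 4 γ ≤ 13 * (Fintype.card V : ℝ) ^ 2 + 113 := by
      exact_mod_cast hγ
    have hcard' : (Fintype.card V : ℝ) = 125 ^ k := by exact_mod_cast hcard
    rw [hcard'] at h hγ'
    have hpos : (0 : ℝ) < ((125 : ℝ) ^ k) ^ 2 := by positivity
    refine le_of_mul_le_mul_right ?_ hpos
    have hone : ((1 / 125 : ℝ) ^ 2) ^ k * ((125 : ℝ) ^ k) ^ 2 = 1 := by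
      rw [← pow_mul, ← pow_mul, mul_comm k 2, ← mul_pow]
      norm_num
    rw [add_mul, mul_assoc (113 / 126 : ℝ), hone]
    linarith
  have hlim : Tendsto (fun k : ℕ => (13 / 126 : ℝ) + 113 / 126 * ((1 / 125 : ℝ) ^ 2) ^ k) atTop
      (𝓝 (13 / 126 + 113 / 126 * 0)) :=
    ((tendsto_pow_atTop_nhds_zero_of_lt_one (by norm_num) (by norm_num)).const_mul _).const_add _
  simpa using ge_of_tendsto' hlim hk

theorem exists_lt_minMonoDensity_add :
    ∃ c : ℝ, 1 / 10 < c ∧ ∀ n : ℕ, 1 ≤ n →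
      c ≤ minMonoDensity (ZMod 5) 2 fourAP n + ((5 : ℝ) ^ n)⁻¹ := by
  obtain ⟨ι, _, _, hι, h⟩ := exists_dim_one_le_properMonoCount (Fin 2)
  have hpos : (0 : ℝ) < (5 : ℝ) ^ Fintype.card ι * ((5 : ℝ) ^ Fintype.card ι - 1) :=
    mul_pos (by positivity) (five_pow_sub_one_pos hι)
  set P : ℝ := (5 : ℝ) ^ Fintype.card ι * ((5 : ℝ) ^ Fintype.card ι - 1) with hP
  -- Monochromatic lines have density at least `P⁻¹` and enter with weight `4 / 10`.
  refine ⟨1 / 10 + 2 / 5 * P⁻¹, by have := inv_pos.mpr hpos; linarith, fun n hn => ?_⟩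
  refine le_minMonoDensity_add hn _ fun γ => ?_
  have h1 := mul_card_sq_le_monoCount (ι := ι) 5 γ 1 fun δ => by exact_mod_cast h δ
  have h2 : ((5 : ℝ) ^ n) ^ 2 + 4 * monoCount 5 γ ≤ 10 * monoCount 4 γ := by
    have := card_sq_add_le_monoCount γ
    simp only [Fintype.card_fun, ZMod.card, Fintype.card_fin] at this
    exact_mod_cast this
  have h3 : P⁻¹ * ((5 : ℝ) ^ n) ^ 2 ≤ monoCount 5 γ := by
    rw [inv_mul_le_iff₀ hpos]
    simpa [ZMod.card] using h1
  linarith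

end Limit

theorem proposition1 :
    ∃ μ : ℝ, IsRadoMultiplicity (ZMod 5) 2 fourAP μ ∧ 1 / 10 < μ ∧ μ ≤ 13 / 126 := by
  set u : ℕ → ℝ := minMonoDensity (ZMod 5) 2 fourAP with hu
  -- The shift skips dimension 0, which has no progressions.
  set M : ℝ := ⨆ m, u (m + 1) with hM
  have hbdd : BddAbove (Set.range fun m => u (m + 1)) :=
    ⟨13 / 126, by rintro _ ⟨m, rfl⟩; exact minMonoDensity_le (Nat.le_add_left 1 m)⟩
  have hupper : ∀ n, 1 ≤ n → u n ≤ M := fun n hn => by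
    obtain ⟨m, rfl⟩ := Nat.exists_eq_add_of_le' hn
    exact le_ciSup hbdd m
  have hlower : ∀ n, 1 ≤ n → M - ((5 : ℝ) ^ n)⁻¹ ≤ u n := fun n hn => by
    rw [sub_le_iff_le_add]
    exact ciSup_le fun m => minMonoDensity_le_add (Nat.le_add_left 1 m) hn
  have hinv : Tendsto (fun n : ℕ => ((5 : ℝ) ^ n)⁻¹) atTop (𝓝 0) := by
    simpa only [inv_pow] using
      tendsto_pow_atTop_nhds_zero_of_lt_one (by norm_num : (0 : ℝ) ≤ 5⁻¹) (by norm_num)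
  have hlim : Tendsto u atTop (𝓝 M) := by
    refine tendsto_of_tendsto_of_tendsto_of_le_of_le' (by simpa using hinv.const_sub M)
      tendsto_const_nhds ?_ ?_
    · filter_upwards [eventually_ge_atTop 1] with n hn using hlower n hn
    · filter_upwards [eventually_ge_atTop 1] with n hn using hupper n hn
  refine ⟨M, hlim, ?_, ciSup_le fun m => minMonoDensity_le (Nat.le_add_left 1 m)⟩
  -- The constant `c` does not depend on `n`, so the strict inequality survives the limit.
  obtain ⟨c, hc, h⟩ := exists_lt_minMonoDensity_add
  have hlim' : Tendsto (fun n => u n + ((5 : ℝ) ^ n)⁻¹) atTop (𝓝 M) := by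
    simpa using hlim.add hinv
  refine hc.trans_le (ge_of_tendsto hlim' ?_)
  filter_upwards [eventually_ge_atTop 1] with n hn using h n hn
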